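/- **Notation.** All functions are real-valued functions on $[0,1]$, with one-sided derivatives at the end points. For $\beta>0$ let $\lfloor\beta\rfloor$ denote the largest integer strictly smaller than $\beta$. Put $\|g\|_\infty=\sup_{x\in[0,1]}|g(x)|$, $$|f|_{C^\beta}=\sup_{x\ne y}\frac{|f^{(\lfloor\beta\rfloor)}(x)-f^{(\lfloor\beta\rfloor)}(y)|}{|x-y|^{\beta-\lfloor\beta\rfloor}},\qquad \|f\|_{C^\beta}=\|f\|_\infty+\|f^{(\lfloor\beta\rfloor)}\|_\infty+|f|_{C^\beta},$$ and let $C^\beta$ be the set of $f$ for which $f^{(\lfloor\beta\rfloor)}$ exists and $\|f\|_{C^\beta}<\infty$. Let $|f|_{\mathcal H^\beta}$ be the infimum of all real $\kappa\ge 0$ such that $$|f^{(j)}(x)|^\beta\le\kappa^j|f(x)|^{\beta-j}\qquad\text{for all }x\in[0,1]\text{ and all integers }1\le j<\beta$$ (so $|f|_{\mathcal H^\beta}=0$ for $\beta\le1$, and $|f|_{\mathcal H^\beta}=\infty$ if there is no such $\kappa$). Put $\|f\|_{\mathcal H^\beta}=\|f\|_{C^\beta}+|f|_{\mathcal H^\beta}$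 and $\mathcal H^\beta=\{f\in C^\beta: f\ge0,\ \|f\|_{\mathcal H^\beta}<\infty\}$. For $s>0$ the Besov (Hölder–Zygmund) space $B^s_{\infty\infty}$ is the set of continuous $f$ on $[0,1]$ with finite norm $$\|f\|_{B^s_{\infty\infty}}=\|f\|_\infty+\sup_{t>0}t^{-s}\omega_r(f,t),\qquad \omega_r(f,t)=\sup\{|\Delta_h^rf(x)|: 0<h\le t,\ x,\,x+rh\in[0,1]\},$$ where $\Delta_hf(x)=f(x+h)-f(x)$, $\Delta_h^r$ is its $r$-th iterate, and $r>s$ is any fixed integer (different choices of $r$ give equivalent norms). **Theorem.** Let $\alpha\in(0,1]$ and $\beta>0$. There is a constant $C$, depending only on $\alpha$ and $\beta$ (and, in (1), on the integer $r>\alpha\beta$ used to define the Besov norm), such that the following hold for all $f\in\mathcal H^\beta$. 1. $f^\alpha\in B^{\alpha\beta}_{\infty\infty}$ and $\|f^\alpha\|_{B^{\alpha\beta}_{\infty\infty}}\le C\,\|f\|_{\mathcal H^\beta}^\alpha$. 2. The derivatives of $f^\alpha$ up to order $\lfloor\alpha\beta\rfloor$ exist on $[0,1]$ and $|f^\alpha|_{\mathcal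 H^{\alpha\beta}}\le C\,|f|_{\mathcal H^\beta}^\alpha$. 3. If $\alpha\beta$ is not an integer, then $f^\alpha\in\mathcal H^{\alpha\beta}$ and $\|f^\alpha\|_{\mathcal H^{\alpha\beta}}\le C\,\|f\|_{\mathcal H^\beta}^\alpha$. -/

import Mathlib

open scoped ENNReal NNReal

namespace FlatHolder

/-- The largest integer strictly smaller than `β` (for `β > 0`). -/
noncomputable def strictFloor (β : ℝ) : ℕ := ⌈β⌉₊ - 1

theorem strictFloor_spec {β : ℝ} (hβ : 0 < β) :
    (strictFloor β : ℝ) < β ∧ β ≤ strictFloor β + 1 := by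
  have h1 : 1 ≤ ⌈β⌉₊ := Nat.one_le_iff_ne_zero.mpr (Nat.ceil_pos.mpr hβ).ne'
  have h2 : (strictFloor β : ℝ) = (⌈β⌉₊ : ℝ) - 1 := by
    simp [strictFloor, Nat.cast_sub h1]
  have h3 := Nat.ceil_lt_add_one hβ.le
  have h4 := Nat.le_ceil β
  constructor <;> linarith

/-- The `j`-th derivative of `f` on `[0,1]` (one-sided at the end points). Functions on `[0,1]` are
represented by functions on `ℝ`, of which only the values on `[0,1]` are used. -/
noncomputable def der (j : ℕ) (f : ℝ → ℝ) : ℝ → ℝ :=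
  iteratedDerivWithin j f (Set.Icc 0 1)

/-- The derivatives of `f` on `[0,1]` up to and including order `k` exist. -/
def DerExists (k : ℕ) (f : ℝ → ℝ) : Prop :=
  ∀ j < k, DifferentiableOn ℝ (der j f) (Set.Icc 0 1)

/-- The supremum norm on `[0,1]`. -/
noncomputable def supNorm (f : ℝ → ℝ) : ℝ≥0∞ :=
  ⨆ x ∈ Set.Icc (0 : ℝ) 1, ‖f x‖ₑ

/-- The Hölder seminorm `|f|_{C^β([0,1])}`. -/
noncomputable def holderSeminorm (β : ℝ) (f : ℝ → ℝ) : ℝ≥0∞ :=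
  ⨆ x ∈ Set.Icc (0 : ℝ) 1, ⨆ y ∈ Set.Icc (0 : ℝ) 1, ⨆ _ : x ≠ y,
    ‖der (strictFloor β) f x - der (strictFloor β) f y‖ₑ /
      ENNReal.ofReal (|x - y| ^ (β - strictFloor β))

/-- The Hölder norm `‖f‖_{C^β([0,1])}`. -/
noncomputable def holderNorm (β : ℝ) (f : ℝ → ℝ) : ℝ≥0∞ :=
  supNorm f + supNorm (der (strictFloor β) f) + holderSeminorm β f

/-- The Hölder space `C^β([0,1])`. -/
def holderSpace (β : ℝ) : Set (ℝ → ℝ) :=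
  {f | DerExists (strictFloor β) f ∧ holderNorm β f < ∞}

/-- The flatness condition `|f^{(j)}(x)|^β ≤ κ^j |f(x)|^{β-j}` for all `x ∈ [0,1]`, `1 ≤ j < β`. -/
def IsFlat (β : ℝ) (f : ℝ → ℝ) (κ : ℝ≥0) : Prop :=
  ∀ x ∈ Set.Icc (0 : ℝ) 1, ∀ j : ℕ, 1 ≤ j → (j : ℝ) < β →
    |der j f x| ^ β ≤ (κ : ℝ) ^ j * |f x| ^ (β - j)

/-- The flatness seminorm `|f|_{𝓗^β}`: the infimum of all `κ ≥ 0` as above (`∞` if there is none;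
it is `0` for `β ≤ 1`, where the condition is empty). -/
noncomputable def flatSeminorm (β : ℝ) (f : ℝ → ℝ) : ℝ≥0∞ :=
  ⨅ (κ : ℝ≥0) (_ : IsFlat β f κ), (κ : ℝ≥0∞)

/-- The norm `‖f‖_{𝓗^β} = ‖f‖_{C^β([0,1])} + |f|_{𝓗^β}`. -/
noncomputable def coneNorm (β : ℝ) (f : ℝ → ℝ) : ℝ≥0∞ :=
  holderNorm β f + flatSeminorm β f

/-- The Hölder cone `𝓗^β`. -/
def holderCone (β : ℝ) : Set (ℝ → ℝ) :=
  {f | f ∈ holderSpace β ∧ (∀ x ∈ Set.Icc (0 : ℝ) 1, 0 ≤ f x) ∧ coneNorm β f < ∞}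

/-- The `r`-th modulus of smoothness `ω_r(f,t)_∞` of `f` on `[0,1]`, i.e. the supremum of
`|Δ_h^r f(x)|` over `0 < h ≤ t` and all `x` with `x, x + r h ∈ [0,1]`. -/
noncomputable def modulus (r : ℕ) (f : ℝ → ℝ) (t : ℝ) : ℝ≥0∞ :=
  ⨆ h ∈ Set.Ioc 0 t, ⨆ x ∈ Set.Icc (0 : ℝ) 1, ⨆ _ : x + r * h ∈ Set.Icc (0 : ℝ) 1,
    ‖(fwdDiff h)^[r] f x‖ₑ

/-- The Besov norm `‖f‖_∞ + sup_{t > 0} t^{-s} ω_r(f,t)_∞` of `B^s_{∞∞}([0,1])`, formed with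
differences of order `r`. All integers `r > s` give equivalent norms. -/
noncomputable def besovNorm (r : ℕ) (s : ℝ) (f : ℝ → ℝ) : ℝ≥0∞ :=
  supNorm f + ⨆ t ∈ Set.Ioi (0 : ℝ), modulus r f t / ENNReal.ofReal (t ^ s)

/-- The Besov (Hölder–Zygmund) space `B^s_{∞∞}([0,1])`, for an integer `r > s`. -/
def besovSpace (r : ℕ) (s : ℝ) : Set (ℝ → ℝ) :=
  {f | ContinuousOn f (Set.Icc 0 1) ∧ besovNorm r s f < ∞}

end FlatHolder

open FlatHolder

open scoped ENNReal NNReal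
open Set Filter Topology FlatHolder

/-! Where `f x > 0`, flatness says that `f` varies on the length scale `(f x / κ) ^ (1 / β)`: the
rescaled function `f / f x` has `j`-th derivative at most `D ^ j` at `x`, with `D = (κ / f x) ^ (1 /
β)`. Powers preserve such geometric bounds, so the `n`-th derivative of `f ^ α` is at most a
constant times `κ ^ (n / β) * f x ^ (α - n / β)` (`exists_abs_der_rpow_le`). At zeros of `f` the
derivatives of `f ^ α` below order `αβ` exist and vanish, because `f y ≤ κ * |y - x| ^ β` near a
zero `x` when `β > 1`. The bound then holds on all of `[0,1]`, and its dependence on `κ` alone gives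
the flatness of `f ^ α`.

For the Hölder bound on the derivative of order `l = ⌊αβ⌋`, take points at distance `h` and compare
`f` with `M * h ^ β`. If `f` is small at both points, the pointwise bound suffices. If it is large
at one of them, `f` is comparable to a constant between them (`comparable`, via the Lipschitz root
`f ^ (1 / β)` when `β > 1`). There one uses the mean value theorem if `l < ⌊β⌋`, and the Hölder
bound on the top derivative of the rescaled `f` if `l = ⌊β⌋`.

The Besov bound follows by applying the mean value theorem `l` times to differences of order `l +
1`. -/

/-! ### Derivatives of powers of functions with values near `1` -/

theorem rpow_le_rpow_abs_of_mem_Icc {b u : ℝ} (hb : 1 ≤ b) (hu : u ∈ Icc b⁻¹ b) (a : ℝ) :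
    u ^ a ≤ b ^ |a| := by
  have hb0 : 0 < b := by linarith
  have hu0 : 0 < u := (inv_pos.2 hb0).trans_le hu.1
  rcases le_total 0 a with ha | ha
  · rw [abs_of_nonneg ha]
    exact Real.rpow_le_rpow hu0.le hu.2 ha
  · rw [abs_of_nonpos ha, Real.rpow_neg hb0.le, ← Real.inv_rpow hb0.le]
    exact Real.rpow_le_rpow_of_nonpos (inv_pos.2 hb0) hu.1 ha

theorem abs_rpow_sub_rpow_le {b u v : ℝ} (hb : 1 ≤ b) (hu : u ∈ Icc b⁻¹ b)
    (hv : v ∈ Icc b⁻¹ b) (a : ℝ) :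
    |u ^ a - v ^ a| ≤ |a| * b ^ |a - 1| * |u - v| := by
  have hb0 : 0 < b := by linarith
  refine Convex.norm_image_sub_le_of_norm_hasDerivWithin_le (s := Icc b⁻¹ b)
    (f := fun w => w ^ a) (f' := fun w => a * w ^ (a - 1)) (fun w hw => ?_) (fun w hw => ?_) (convex_Icc _ _) hv hu
  · exact (Real.hasDerivAt_rpow_const (.inl ((inv_pos.2 hb0).trans_le hw.1).ne')).hasDerivWithinAt
  · have hw0 : 0 < w := (inv_pos.2 hb0).trans_le hw.1
    rw [Real.norm_eq_abs, abs_mul, abs_of_pos (Real.rpow_pos_of_pos hw0 _)]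
    gcongr
    exact rpow_le_rpow_abs_of_mem_Icc hb hw _

/-- If `F` is close to `1` and its derivatives satisfy geometric bounds at two points, then so do
the derivatives of `F ^ a`, together with their differences. -/
theorem exists_iteratedDerivWithin_rpow_bound {b : ℝ} (hb : 1 ≤ b) (n : ℕ) :
    ∀ a : ℝ, ∃ C : ℝ, 0 ≤ C ∧ ∀ (S : Set ℝ) (F : ℝ → ℝ) (x y D δ : ℝ), UniqueDiffOn ℝ S →
      ContDiffOn ℝ n F S → x ∈ S → y ∈ S → F x ∈ Icc b⁻¹ b → F y ∈ Icc b⁻¹ b → 0 ≤ D → 0 ≤ δ →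
      (∀ i, 1 ≤ i → i ≤ n → |iteratedDerivWithin i F S x| ≤ D ^ i) →
      (∀ i, 1 ≤ i → i ≤ n → |iteratedDerivWithin i F S y| ≤ D ^ i) →
      (∀ i ≤ n, |iteratedDerivWithin i F S x - iteratedDerivWithin i F S y| ≤ δ * D ^ i) →
      |iteratedDerivWithin n (fun z => F z ^ a) S x| ≤ C * D ^ n ∧
      |iteratedDerivWithin n (fun z => F z ^ a) S x - iteratedDerivWithin n (fun z => F z ^ a) S y|
        ≤ C * δ * D ^ n := by
  have hb0 : 0 < b := by linarith
  induction n using Nat.strong_induction_on with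
  | _ n ih =>
  intro a
  rcases n with _ | n
  · refine ⟨max (b ^ |a|) (|a| * b ^ |a - 1|), by positivity, ?_⟩
    intro S F x y D δ hS hF hx hy hFx hFy hD hδ h1 h2 h3
    have hpos : 0 < F x := (inv_pos.2 hb0).trans_le hFx.1
    have h30 := h3 0 le_rfl
    simp only [iteratedDerivWithin_zero, pow_zero, mul_one] at h30 ⊢
    constructor
    · rw [abs_of_pos (Real.rpow_pos_of_pos hpos _)]
      exact (rpow_le_rpow_abs_of_mem_Icc hb hFx a).trans (le_max_left _ _)
    · refine (abs_rpow_sub_rpow_le hb hFx hFy a).trans ?_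
      gcongr
      exact le_max_right _ _
  -- Apply Leibniz to `(F ^ a)' = a * F ^ (a - 1) * F'`: every lower order occurs, with exponent `a
  -- - 1`, hence strong induction with `a` quantified inside.
  · have ih' : ∀ i : ℕ, i < n + 1 → _ := fun i hi => ih i hi (a - 1)
    choose! C hC0 hC using ih'
    -- The factor `2` pays for splitting a difference of products into two terms.
    refine ⟨|a| * ∑ i ∈ Finset.range (n + 1), (n.choose i : ℝ) * (2 * C i), ?_, ?_⟩
    · refine mul_nonneg (abs_nonneg _) (Finset.sum_nonneg fun i hi => ?_)
      have := hC0 i (Finset.mem_range.1 hi)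
      positivity
    intro S F x y D δ hS hF hx hy hFx hFy hD hδ h1 h2 h3
    have hF' : ContDiffOn ℝ n (derivWithin F S) S := by
      refine hF.derivWithin hS ?_
      norm_cast
    have key : ∀ z ∈ S, 0 < F z → iteratedDerivWithin (n + 1) (fun w => F w ^ a) S z =
        a * ∑ i ∈ Finset.range (n + 1), (n.choose i : ℝ) *
          (iteratedDerivWithin i (fun w => F w ^ (a - 1)) S z *
            iteratedDerivWithin (n - i + 1) F S z) := by
      intro z hz hFz
      have hev : derivWithin (fun w => F w ^ a) S =ᶠ[𝓝[S] z]
          fun w => a * (F w ^ (a - 1) * derivWithin F S w) := by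
        have hpos : ∀ᶠ w in 𝓝[S] z, 0 < F w :=
          (hF.continuousOn z hz).eventually (lt_mem_nhds hFz)
        filter_upwards [hpos, self_mem_nhdsWithin] with w hw hwS
        rw [derivWithin_rpow_const ((hF.differentiableOn (by simp)) w hwS) (.inl hw.ne')
          (hS w hwS)]
        ring
      rw [iteratedDerivWithin_succ', hev.iteratedDerivWithin_eq (hev.self_of_nhdsWithin hz),
        iteratedDerivWithin_const_mul_field]
      congr 1
      have hFn : ContDiffWithinAt ℝ n F S z := (hF z hz).of_le (by norm_cast; omega)
      refine (iteratedDerivWithin_mul hz hS (hFn.rpow_const_of_ne hFz.ne') (hF' z hz)).trans ?_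
      refine Finset.sum_congr rfl fun i hi => ?_
      rw [iteratedDerivWithin_succ', mul_assoc]
    have hFx0 : 0 < F x := (inv_pos.2 hb0).trans_le hFx.1
    have hFy0 : 0 < F y := (inv_pos.2 hb0).trans_le hFy.1
    rw [key x hx hFx0, key y hy hFy0]
    have hi1 : ∀ i ∈ Finset.range (n + 1), _ := fun i hi =>
      hC i (Finset.mem_range.1 hi) S F x y D δ hS
        (hF.of_le (by have := Finset.mem_range.1 hi; norm_cast; omega)) hx hy hFx hFy hD hδ
        (fun j hj hj' => h1 j hj (by have := Finset.mem_range.1 hi; omega))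
        (fun j hj hj' => h2 j hj (by have := Finset.mem_range.1 hi; omega))
        (fun j hj' => h3 j (by have := Finset.mem_range.1 hi; omega))
    -- Exchanging `x` and `y` yields the size bound at `y`.
    have hi2 : ∀ i ∈ Finset.range (n + 1), _ := fun i hi =>
      hC i (Finset.mem_range.1 hi) S F y x D δ hS
        (hF.of_le (by have := Finset.mem_range.1 hi; norm_cast; omega)) hy hx hFy hFx hD hδ
        (fun j hj hj' => h2 j hj (by have := Finset.mem_range.1 hi; omega))
        (fun j hj hj' => h1 j hj (by have := Finset.mem_range.1 hi; omega))
        (fun j hj' => by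
          rw [abs_sub_comm]; exact h3 j (by have := Finset.mem_range.1 hi; omega))
    have hpow : ∀ i ∈ Finset.range (n + 1), D ^ i * D ^ (n - i + 1) = D ^ (n + 1) := by
      intro i hi
      rw [← pow_add]; congr 1; have := Finset.mem_range.1 hi; omega
    constructor
    · rw [abs_mul, mul_assoc]
      gcongr
      rw [Finset.sum_mul]
      refine (Finset.abs_sum_le_sum_abs _ _).trans (Finset.sum_le_sum fun i hi => ?_)
      have hCi := hC0 i (Finset.mem_range.1 hi)
      rw [abs_mul, Nat.abs_cast, mul_assoc, abs_mul]
      refine mul_le_mul_of_nonneg_left ?_ (Nat.cast_nonneg _)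
      calc _ ≤ (C i * D ^ i) * D ^ (n - i + 1) := by
            gcongr
            · exact (hi1 i hi).1
            · exact h1 _ (by omega) (by omega)
        _ = C i * D ^ (n + 1) := by rw [mul_assoc, hpow i hi]
        _ ≤ 2 * C i * D ^ (n + 1) := by gcongr; linarith
    · rw [← mul_sub, abs_mul, mul_assoc, mul_assoc]
      gcongr
      rw [← Finset.sum_sub_distrib, Finset.sum_mul]
      refine (Finset.abs_sum_le_sum_abs _ _).trans (Finset.sum_le_sum fun i hi => ?_)
      have hCi := hC0 i (Finset.mem_range.1 hi)
      rw [← mul_sub, abs_mul, Nat.abs_cast, mul_assoc]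
      gcongr
      set u := iteratedDerivWithin i (fun w => F w ^ (a - 1)) S x
      set u' := iteratedDerivWithin i (fun w => F w ^ (a - 1)) S y
      set v := iteratedDerivWithin (n - i + 1) F S x
      set v' := iteratedDerivWithin (n - i + 1) F S y
      calc |u * v - u' * v'| = |(u - u') * v + u' * (v - v')| := by ring_nf
        _ ≤ |u - u'| * |v| + |u'| * |v - v'| := by
            rw [← abs_mul, ← abs_mul]; exact abs_add_le _ _
        _ ≤ (C i * δ * D ^ i) * D ^ (n - i + 1) + (C i * D ^ i) * (δ * D ^ (n - i + 1)) := by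
            gcongr
            · exact (hi1 i hi).2
            · exact h1 _ (by omega) (by omega)
            · exact (hi2 i hi).1
            · exact h3 _ (by omega)
        _ = 2 * C i * (δ * (D ^ i * D ^ (n - i + 1))) := by ring
        _ = _ := by rw [hpow i hi]

/-! ### Finite differences -/

theorem hasDerivWithinAt_fwdDiff_iterate {G : ℝ → ℝ} {h : ℝ} (hh : 0 ≤ h) {S : Set ℝ}
    (hG : DifferentiableOn ℝ G S) (n : ℕ) : ∀ p q : ℝ, Icc p (q + n * h) ⊆ S → ∀ z ∈ Icc p q,
    HasDerivWithinAt ((fwdDiff h)^[n] G) ((fwdDiff h)^[n] (derivWithin G S) z) (Icc p q) z := by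
  induction n with
  | zero =>
    intro p q hS z hz
    have hS' : Icc p q ⊆ S := by simpa using hS
    exact ((hG z (hS' hz)).hasDerivWithinAt).mono hS'
  | succ n ih =>
    intro p q hS z hz
    push_cast at hS
    have hnh : 0 ≤ n * h := by positivity
    simp only [Function.iterate_succ_apply']
    refine HasDerivWithinAt.sub ?_ (ih p q (fun w hw => hS ⟨hw.1, by nlinarith [hw.2]⟩) z hz)
    have h1 := ih (p + h) (q + h) (fun w hw => hS ⟨by linarith [hw.1], by nlinarith [hw.2]⟩)
      (z + h) ⟨by linarith [hz.1], by linarith [hz.2]⟩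
    have h2 := h1.comp z ((hasDerivAt_id z).add_const h).hasDerivWithinAt
      (fun w (hw : w ∈ Icc p q) => (⟨by simpa using hw.1, by simpa using hw.2⟩ :
        id w + h ∈ Icc (p + h) (q + h)))
    simpa [Function.comp_def] using h2

/-- Differences commute with differentiation, so the mean value theorem on `[x, x + h]` trades one
difference for a factor `h` and a derivative; after `l` trades the Hölder bound handles the last
difference. -/
theorem abs_fwdDiff_iterate_succ_le {h K γ : ℝ} (hh : 0 < h) {S : Set ℝ} (hS : S.OrdConnected)
    (l : ℕ) : ∀ G : ℝ → ℝ,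
      (∀ j < l, DifferentiableOn ℝ (iteratedDerivWithin j G S) S) →
      (∀ u ∈ S, ∀ v ∈ S, |iteratedDerivWithin l G S u - iteratedDerivWithin l G S v| ≤
        K * |u - v| ^ γ) →
      ∀ x, x ∈ S → x + (l + 1) * h ∈ S →
      |(fwdDiff h)^[l + 1] G x| ≤ K * h ^ γ * h ^ l := by
  induction l with
  | zero =>
    intro G _ hK x hx hx'
    have hx'' : x + h ∈ S := by simpa using hx'
    have := hK (x + h) hx'' x hx
    simpa [fwdDiff, abs_of_pos hh] using this
  | succ l ih =>
    intro G hd hK x hx hx'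
    have hsub : Icc x (x + h + (l + 1 : ℕ) * h) ⊆ S := by
      have : x + h + (l + 1 : ℕ) * h = x + ((l + 1 : ℕ) + 1) * h := by ring
      rw [this]
      exact hS.out hx hx'
    have hder := hasDerivWithinAt_fwdDiff_iterate hh.le
      (by simpa using hd 0 (by omega)) (l + 1) x (x + h) hsub
    rw [Function.iterate_succ_apply', fwdDiff]
    have := Convex.norm_image_sub_le_of_norm_hasDerivWithin_le (C := K * h ^ γ * h ^ l) hder
      (fun z hz => ?_) (convex_Icc _ _) (left_mem_Icc.2 (by linarith : x ≤ x + h))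
      (right_mem_Icc.2 (by linarith : x ≤ x + h))
    · refine this.trans_eq ?_
      rw [add_sub_cancel_left, Real.norm_eq_abs, abs_of_pos hh, pow_succ]; ring
    · refine ih (derivWithin G S) (fun j hj => ?_) (fun u hu v hv => ?_) z ?_ ?_
      · rw [← iteratedDerivWithin_succ']; exact hd (j + 1) (by omega)
      · rw [← iteratedDerivWithin_succ']; exact hK u hu v hv
      · refine hsub ⟨hz.1, hz.2.trans ?_⟩
        have : (0 : ℝ) ≤ (l + 1 : ℕ) * h := by positivity
        linarith
      · refine hsub ⟨?_, ?_⟩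
        · have : (0 : ℝ) ≤ (l + 1) * h := by positivity
          linarith [hz.1]
        · push_cast; linarith [hz.2]

theorem abs_fwdDiff_iterate_add_le {G : ℝ → ℝ} {h K : ℝ} (hh : 0 ≤ h) {S : Set ℝ}
    (hS : S.OrdConnected) {n : ℕ}
    (hG : ∀ x, x ∈ S → x + n * h ∈ S → |(fwdDiff h)^[n] G x| ≤ K) (m : ℕ) :
    ∀ x, x ∈ S → x + (n + m : ℕ) * h ∈ S → |(fwdDiff h)^[n + m] G x| ≤ 2 ^ m * K := by
  induction m with
  | zero => simpa using hG
  | succ m ih =>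
    intro x hx hx'
    have hnm : (0 : ℝ) ≤ (n + m : ℕ) * h := by positivity
    have hx2 : x + (n + m : ℕ) * h + h ∈ S := by
      convert hx' using 1; push_cast; ring
    have h1 := ih x hx (hS.out hx hx2 ⟨by linarith, by linarith⟩)
    have h2 := ih (x + h) (hS.out hx hx2 ⟨by linarith, by linarith⟩) (by convert hx2 using 1; ring)
    rw [← add_assoc, Function.iterate_succ_apply', fwdDiff]
    refine (abs_sub _ _).trans ?_
    rw [pow_succ]; linarith

/-! ### Flat functions: pointwise bounds and comparability -/

/-- Real-valued consequences of `f ∈ 𝓗^β` with flatness constant `κ` and Hölder constant `M`. -/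
structure FlatBounds (β κ M : ℝ) (f : ℝ → ℝ) : Prop where
  pos_exponent : 0 < β
  flat_nonneg : 0 ≤ κ
  flat_le : κ ≤ M
  contDiffOn : ContDiffOn ℝ (strictFloor β) f (Icc 0 1)
  nonneg : ∀ x ∈ Icc (0 : ℝ) 1, 0 ≤ f x
  der_le : ∀ x ∈ Icc (0 : ℝ) 1, 0 < f x → ∀ j ≤ strictFloor β,
    |der j f x| ≤ f x * ((κ / f x) ^ (1 / β)) ^ j
  der_eq_zero : ∀ x ∈ Icc (0 : ℝ) 1, f x = 0 → ∀ j, 1 ≤ j → j ≤ strictFloor β → der j f x = 0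
  holder : ∀ x ∈ Icc (0 : ℝ) 1, ∀ y ∈ Icc (0 : ℝ) 1,
    |der (strictFloor β) f x - der (strictFloor β) f y| ≤ M * |x - y| ^ (β - strictFloor β)

/-- The left side is the form produced by rescaling. The right side shows the sign of the exponent
of `s`, which decides whether upper or lower bounds on `s` are useful. -/
theorem rpow_mul_root_pow {α β κ s : ℝ} (hκ : 0 ≤ κ) (hs : 0 < s) (j : ℕ) :
    s ^ α * ((κ / s) ^ (1 / β)) ^ j = κ ^ (j / β) * s ^ (α - j / β) := by
  rw [← Real.rpow_mul_natCast (by positivity), show 1 / β * (j : ℝ) = j / β by ring,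
    Real.div_rpow hκ hs.le, Real.rpow_sub hs]
  have := Real.rpow_pos_of_pos hs (j / β)
  field_simp

/-- Evaluates the derivative bound at the threshold value `M * h ^ β` of `f`. -/
theorem rpow_mul_mul_rpow {α β M h : ℝ} (hβ : 0 < β) (hM : 0 < M) (hh : 0 ≤ h) (j : ℕ) :
    M ^ (j / β) * (M * h ^ β) ^ (α - j / β) = M ^ α * h ^ (α * β - j) := by
  rw [Real.mul_rpow hM.le (by positivity), ← mul_assoc, ← Real.rpow_add hM, ← Real.rpow_mul hh]
  congr 2
  · ring
  · field_simp

theorem strictFloor_mono {a b : ℝ} (h : a ≤ b) : strictFloor a ≤ strictFloor b :=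
  Nat.sub_le_sub_right (Nat.ceil_mono h) 1

theorem natCast_le_strictFloor {β : ℝ} {j : ℕ} (hj : (j : ℝ) < β) : j ≤ strictFloor β :=
  Nat.le_sub_one_of_lt (Nat.lt_ceil.2 hj)

theorem strictFloor_eq_zero {β : ℝ} (h : β ≤ 1) : strictFloor β = 0 := by
  have : ⌈β⌉₊ ≤ 1 := Nat.ceil_le.2 (by simpa using h)
  simp only [strictFloor]; omega

theorem one_le_strictFloor {β : ℝ} (h : 1 < β) : 1 ≤ strictFloor β :=
  natCast_le_strictFloor (by simpa using h)

theorem uniqueDiffOn_unitInterval : UniqueDiffOn ℝ (Icc (0 : ℝ) 1) := uniqueDiffOn_Icc zero_lt_one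

theorem hasDerivWithinAt_zero_of_abs_le {G : ℝ → ℝ} {S : Set ℝ} {x K p : ℝ} (hp : 1 < p)
    (hx : G x = 0) (hG : ∀ y ∈ S, |G y| ≤ K * |y - x| ^ p) : HasDerivWithinAt G 0 S x := by
  rw [hasDerivWithinAt_iff_isLittleO]
  simp only [hx, sub_zero, smul_zero]
  have h1 : G =O[𝓝[S] x] fun y => |y - x| ^ p :=
    Asymptotics.IsBigO.of_bound K (eventually_nhdsWithin_of_forall fun y hy => by
      rw [Real.norm_eq_abs, Real.norm_of_nonneg (by positivity)]; exact hG y hy)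
  refine h1.trans_isLittleO ?_
  have h2 : (fun y => |y - x| ^ p) = fun y => |y - x| ^ (p - 1) * |y - x| := by
    funext y
    rcases eq_or_ne y x with rfl | hne
    · simp [Real.zero_rpow (by linarith : p ≠ 0)]
    · rw [Real.rpow_sub_one (abs_pos.2 (sub_ne_zero.2 hne)).ne']
      have := abs_pos.2 (sub_ne_zero.2 hne)
      field_simp
  rw [h2]
  have h3 : (fun y => |y - x| ^ (p - 1)) =o[𝓝[S] x] fun _ => (1 : ℝ) := by
    rw [Asymptotics.isLittleO_one_iff]
    have : ContinuousAt (fun y => |y - x| ^ (p - 1)) x :=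
      ContinuousAt.rpow_const (by fun_prop) (.inr (by linarith))
    have h4 := this.tendsto
    simp only [sub_self, abs_zero, Real.zero_rpow (by linarith : p - 1 ≠ 0)] at h4
    exact h4.mono_left nhdsWithin_le_nhds
  have h5 := h3.mul_isBigO (Asymptotics.isBigO_refl (fun y => |y - x|) (𝓝[S] x))
  simp only [one_mul] at h5
  exact (Asymptotics.isLittleO_abs_right).1 h5

namespace FlatBounds

variable {β κ M : ℝ} {f : ℝ → ℝ}

theorem differentiableOn_der (hf : FlatBounds β κ M f) {j : ℕ} (hj : j < strictFloor β) :
    DifferentiableOn ℝ (der j f) (Icc 0 1) :=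
  hf.contDiffOn.differentiableOn_iteratedDerivWithin (by exact_mod_cast hj)
    uniqueDiffOn_unitInterval

theorem abs_der_one_le (hf : FlatBounds β κ M f) (hβ : 1 < β) {x ε : ℝ} (hx : x ∈ Icc (0 : ℝ) 1)
    (hε : 0 < ε) : |der 1 f x| ≤ κ ^ (1 / β) * (f x + ε) ^ (1 - 1 / β) := by
  have hk := one_le_strictFloor hβ
  have h0 := hf.nonneg x hx
  have hκ := hf.flat_nonneg
  have he : 0 ≤ 1 - 1 / β := by rw [sub_nonneg, div_le_one (by linarith)]; exact hβ.le
  rcases h0.eq_or_lt with h | h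
  · rw [hf.der_eq_zero x hx h.symm 1 le_rfl hk, abs_zero]; positivity
  · have h1 := hf.der_le x hx h 1 hk
    have h2 := rpow_mul_root_pow (α := 1) (β := β) hκ h 1
    rw [Real.rpow_one, Nat.cast_one] at h2
    rw [h2] at h1
    refine h1.trans ?_
    gcongr
    linarith

/-- The root `f ^ (1 / β)` of a flat function is Lipschitz. -/
theorem abs_root_sub_root_le (hf : FlatBounds β κ M f) (hβ : 1 < β) {x y : ℝ}
    (hx : x ∈ Icc (0 : ℝ) 1) (hy : y ∈ Icc (0 : ℝ) 1) :
    |f x ^ (1 / β) - f y ^ (1 / β)| ≤ κ ^ (1 / β) * |x - y| := by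
  have hκ := hf.flat_nonneg
  have hb : 0 < 1 / β := by have := hf.pos_exponent; positivity
  have hb1 : 1 / β ≤ 1 := by rw [div_le_one (by linarith)]; exact hβ.le
  -- The root need not be differentiable at zeros of `f`; shift by `ε` and let `ε` tend to `0`.
  have hε : ∀ ε : ℝ, 0 < ε →
      |(f x + ε) ^ (1 / β) - (f y + ε) ^ (1 / β)| ≤ κ ^ (1 / β) * |x - y| := by
    intro ε hε
    have hpos : ∀ z ∈ Icc (0 : ℝ) 1, 0 < f z + ε := fun z hz => by linarith [hf.nonneg z hz]
    refine Convex.norm_image_sub_le_of_norm_hasDerivWithin_le (s := Icc (0 : ℝ) 1)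
      (f := fun z => (f z + ε) ^ (1 / β))
      (f' := fun z => der 1 f z * (1 / β) * (f z + ε) ^ (1 / β - 1)) (fun z hz => ?_)
      (fun z hz => ?_) (convex_Icc _ _) hy hx
    · have h1 := hf.differentiableOn_der (one_le_strictFloor hβ) z hz
      have h2 : HasDerivWithinAt f (der 1 f z) (Icc 0 1) z := by
        have := h1.hasDerivWithinAt
        simpa [der, iteratedDerivWithin_one] using this
      exact (h2.add_const ε).rpow_const (.inl (hpos z hz).ne')
    · have hz0 := hpos z hz
      rw [Real.norm_eq_abs, abs_mul, abs_mul, abs_of_pos hb,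
        abs_of_pos (Real.rpow_pos_of_pos hz0 _)]
      calc |der 1 f z| * (1 / β) * (f z + ε) ^ (1 / β - 1)
          ≤ (κ ^ (1 / β) * (f z + ε) ^ (1 - 1 / β)) * 1 * (f z + ε) ^ (1 / β - 1) := by
            gcongr
            exact hf.abs_der_one_le hβ hz hε
        _ = κ ^ (1 / β) * ((f z + ε) ^ (1 - 1 / β) * (f z + ε) ^ (1 / β - 1)) := by ring
        _ = κ ^ (1 / β) := by rw [← Real.rpow_add hz0]; simp
  have hc : ∀ z, Tendsto (fun ε => (f z + ε) ^ (1 / β)) (𝓝[>] 0) (𝓝 (f z ^ (1 / β))) := by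
    intro z
    have : ContinuousAt (fun ε => (f z + ε) ^ (1 / β)) 0 :=
      ContinuousAt.rpow_const (by fun_prop) (.inr hb.le)
    have h := this.tendsto
    rw [add_zero] at h
    exact h.mono_left nhdsWithin_le_nhds
  exact le_of_tendsto ((hc x).sub (hc y)).abs (eventually_nhdsWithin_of_forall fun ε h => hε ε h)

theorem le_of_eq_zero (hf : FlatBounds β κ M f) (hβ : 1 < β) {x y : ℝ}
    (hx : x ∈ Icc (0 : ℝ) 1) (hy : y ∈ Icc (0 : ℝ) 1) (h0 : f x = 0) :
    f y ≤ κ * |y - x| ^ β := by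
  have hβ0 := hf.pos_exponent
  have h := hf.abs_root_sub_root_le hβ hy hx
  have hy0 := hf.nonneg y hy
  have hκ := hf.flat_nonneg
  rw [h0, Real.zero_rpow (by positivity), sub_zero, abs_of_nonneg (by positivity)] at h
  have h2 := Real.rpow_le_rpow (by positivity) h hβ0.le
  rwa [Real.mul_rpow (by positivity) (by positivity), ← Real.rpow_mul hy0, ← Real.rpow_mul hκ,
    one_div_mul_cancel hβ0.ne', Real.rpow_one, Real.rpow_one] at h2

/-- At distance at most `h` from a point with `f x ≥ 2 ^ (β + 1) M h ^ β`, the values of `f` are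
comparable with `f x`. -/
theorem comparable (hf : FlatBounds β κ M f) {x y h : ℝ} (hM : 0 < M)
    (hx : x ∈ Icc (0 : ℝ) 1) (hy : y ∈ Icc (0 : ℝ) 1) (hxy : |x - y| ≤ h)
    (hbig : 2 ^ (β + 1) * (M * h ^ β) ≤ f x) :
    f x ≤ 2 ^ (β + 1) * f y ∧ f y ≤ 2 ^ (β + 1) * f x := by
  have hβ := hf.pos_exponent
  have hκ := hf.flat_nonneg
  have hh : 0 ≤ h := (abs_nonneg _).trans hxy
  have hx0 := hf.nonneg x hx
  have hy0 := hf.nonneg y hy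
  have h2 : (2 : ℝ) ≤ 2 ^ (β + 1) := by
    simpa using Real.rpow_le_rpow_of_exponent_le (x := 2) one_le_two (by linarith : 1 ≤ β + 1)
  have h2' : (2 : ℝ) ^ β ≤ 2 ^ (β + 1) :=
    Real.rpow_le_rpow_of_exponent_le one_le_two (by linarith)
  -- For `β ≤ 1` the flatness condition is empty and the Hölder bound moves `f` by at most `f x /
  -- 2`. For `β > 1` the roots differ by at most half of the root at `x`, so they agree up to a
  -- factor `2`, and `f` up to `2 ^ β`.
  rcases le_or_gt β 1 with hβ1 | hβ1
  · have h3 := hf.holder x hx y hy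
    rw [strictFloor_eq_zero hβ1] at h3
    simp only [der, iteratedDerivWithin_zero, Nat.cast_zero, sub_zero] at h3
    have h4 : M * |x - y| ^ β ≤ M * h ^ β := by gcongr
    have h5 : 0 ≤ M * h ^ β := by positivity
    have h6 := abs_le.1 (h3.trans h4)
    constructor <;> nlinarith
  · have h3 := hf.abs_root_sub_root_le hβ1 hx hy
    set u := f x ^ (1 / β)
    set v := f y ^ (1 / β)
    have hu0 : 0 ≤ u := by positivity
    have hv0 : 0 ≤ v := by positivity
    have huβ : u ^ β = f x := by
      rw [← Real.rpow_mul hx0, one_div_mul_cancel hβ.ne', Real.rpow_one]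
    have hvβ : v ^ β = f y := by
      rw [← Real.rpow_mul hy0, one_div_mul_cancel hβ.ne', Real.rpow_one]
    have h4 : κ ^ (1 / β) * |x - y| ≤ M ^ (1 / β) * h := by
      gcongr
      exact hf.flat_le
    have h5 : 2 * (M ^ (1 / β) * h) ≤ u := by
      have h6 : (2 * (M ^ (1 / β) * h)) ^ β ≤ u ^ β := by
        rw [huβ, Real.mul_rpow zero_le_two (by positivity), Real.mul_rpow (by positivity) hh,
          ← Real.rpow_mul hM.le, one_div_mul_cancel hβ.ne', Real.rpow_one]
        refine le_trans ?_ hbig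
        gcongr
      exact (Real.rpow_le_rpow_iff (by positivity) hu0 hβ).1 h6
    have h6 := abs_le.1 (h3.trans h4)
    have h7 : u ≤ 2 * v := by linarith
    have h8 : v ≤ 2 * u := by linarith
    constructor
    · rw [← huβ, ← hvβ]
      calc u ^ β ≤ (2 * v) ^ β := by gcongr
        _ = 2 ^ β * v ^ β := Real.mul_rpow zero_le_two hv0
        _ ≤ _ := by gcongr
    · rw [← huβ, ← hvβ]
      calc v ^ β ≤ (2 * u) ^ β := by gcongr
        _ = 2 ^ β * u ^ β := Real.mul_rpow zero_le_two hu0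
        _ ≤ _ := by gcongr

theorem contDiffWithinAt_rpow (hf : FlatBounds β κ M f) (α : ℝ) {x : ℝ} (hx : x ∈ Icc (0 : ℝ) 1)
    (h : 0 < f x) : ContDiffWithinAt ℝ (strictFloor β) (fun z => f z ^ α) (Icc 0 1) x :=
  (hf.contDiffOn x hx).rpow_const_of_ne h.ne'

theorem differentiableWithinAt_der_rpow (hf : FlatBounds β κ M f) (α : ℝ) {x : ℝ}
    (hx : x ∈ Icc (0 : ℝ) 1) (h : 0 < f x) {j : ℕ} (hj : j < strictFloor β) :
    DifferentiableWithinAt ℝ (der j fun z => f z ^ α) (Icc 0 1) x :=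
  (hf.contDiffWithinAt_rpow α hx h).differentiableWithinAt_iteratedDerivWithin
    (by exact_mod_cast hj) (by rw [insert_eq_of_mem hx]; exact uniqueDiffOn_unitInterval)

theorem der_rpow_div (hf : FlatBounds β κ M f) (α : ℝ) {c x : ℝ} (hc : 0 < c)
    (hx : x ∈ Icc (0 : ℝ) 1) (n : ℕ) :
    iteratedDerivWithin n (fun z => (c⁻¹ * f z) ^ α) (Icc 0 1) x =
      (c ^ α)⁻¹ * der n (fun z => f z ^ α) x := by
  rw [der, ← iteratedDerivWithin_const_mul_field]
  refine iteratedDerivWithin_congr (fun z hz => ?_) hx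
  rw [Real.mul_rpow (by positivity) (hf.nonneg z hz), Real.inv_rpow hc.le]

/-- Chain rule estimate for the derivatives of `f ^ α` at points where `f` is positive. -/
theorem exists_abs_der_rpow_le (α β : ℝ) : ∃ C : ℝ, 1 ≤ C ∧ ∀ (κ M : ℝ) (f : ℝ → ℝ),
    FlatBounds β κ M f → ∀ x ∈ Icc (0 : ℝ) 1, 0 < f x → ∀ n ≤ strictFloor β,
      |der n (fun z => f z ^ α) x| ≤ C * (f x ^ α * ((κ / f x) ^ (1 / β)) ^ n) := by
  choose C hC0 hC using fun n => exists_iteratedDerivWithin_rpow_bound le_rfl n α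
  refine ⟨1 + ∑ n ∈ Finset.range (strictFloor β + 1), C n,
    le_add_of_nonneg_right (Finset.sum_nonneg fun n _ => hC0 n), ?_⟩
  intro κ M f hf x hx hfx n hn
  have hκ := hf.flat_nonneg
  have h1 : ∀ i, 1 ≤ i → i ≤ n →
      |iteratedDerivWithin i (fun z => (f x)⁻¹ * f z) (Icc 0 1) x| ≤
        ((κ / f x) ^ (1 / β)) ^ i := by
    intro i _ hi
    rw [iteratedDerivWithin_const_mul_field, abs_mul, abs_of_pos (inv_pos.2 hfx),
      inv_mul_le_iff₀ hfx]
    exact hf.der_le x hx hfx i (hi.trans hn)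
  have hmem : (f x)⁻¹ * f x ∈ Icc (1 : ℝ)⁻¹ 1 := by
    rw [inv_mul_cancel₀ hfx.ne']; simp
  -- Only the size bound is needed, so both points are `x` and `δ = 0`; the rescaled function equals
  -- `1` there, which permits `b = 1`.
  have h2 := (hC n (Icc 0 1) (fun z => (f x)⁻¹ * f z) x x ((κ / f x) ^ (1 / β)) 0
    uniqueDiffOn_unitInterval
    (contDiffOn_const.mul (hf.contDiffOn.of_le (by exact_mod_cast hn))) hx hx hmem hmem
    (by positivity) le_rfl h1 h1 (by simp)).1
  rw [hf.der_rpow_div α hfx hx, abs_mul, abs_of_pos (by positivity),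
    inv_mul_le_iff₀ (by positivity)] at h2
  refine h2.trans ?_
  have h3 : C n ≤ 1 + ∑ n ∈ Finset.range (strictFloor β + 1), C n := by
    have := Finset.single_le_sum (f := C) (fun i _ => hC0 i)
      (Finset.mem_range.2 (Nat.lt_succ_of_le hn))
    linarith
  calc f x ^ α * (C n * ((κ / f x) ^ (1 / β)) ^ n)
      = C n * (f x ^ α * ((κ / f x) ^ (1 / β)) ^ n) := by ring
    _ ≤ _ := by gcongr

end FlatBounds

/-! ### Vanishing at zeros and the Hölder estimate for the derivatives of `f ^ α` -/

namespace FlatBounds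

variable {β κ M : ℝ} {f : ℝ → ℝ}

/-- Near a zero of `f` the `j`-th derivative is `O(|y - x| ^ (αβ - j))`, and `αβ - j > 1` because `j
+ 1 ≤ ⌊αβ⌋ < αβ`. The chain rule bound covers only points with `f y > 0`; `hz'` covers other zeros,
which may accumulate at `x`. This is the induction step of `der_rpow_eq_zero`. -/
theorem hasDerivWithinAt_der_rpow_zero (hf : FlatBounds β κ M f) {α : ℝ} (hα : 0 < α)
    (hα1 : α ≤ 1) {x : ℝ} (hx : x ∈ Icc (0 : ℝ) 1) (h0 : f x = 0) {j : ℕ}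
    (hj : j < strictFloor (α * β)) (hz : der j (fun z => f z ^ α) x = 0)
    (hz' : ∀ y ∈ Icc (0 : ℝ) 1, f y = 0 → der j (fun z => f z ^ α) y = 0) :
    HasDerivWithinAt (der j fun z => f z ^ α) 0 (Icc 0 1) x := by
  have hβ := hf.pos_exponent
  have hκ := hf.flat_nonneg
  have hl := (strictFloor_spec (mul_pos hα hβ)).1
  have hj1 : (j : ℝ) + 1 ≤ strictFloor (α * β) := by exact_mod_cast hj
  have hj0 : (0 : ℝ) ≤ j := Nat.cast_nonneg j
  have hαβ : α * β ≤ β := by nlinarith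
  obtain ⟨C, hC1, hC⟩ := exists_abs_der_rpow_le α β
  have hexp : 0 < α - j / β := by rw [sub_pos, div_lt_iff₀ hβ]; linarith
  refine hasDerivWithinAt_zero_of_abs_le
    (K := C * (κ ^ (j / β) * κ ^ (α - j / β))) (p := α * β - j) (by linarith) hz fun y hy => ?_
  rcases (hf.nonneg y hy).eq_or_lt with h | h
  · rw [hz' y hy h.symm, abs_zero]; positivity
  · have h1 := hC κ M f hf y hy h j (hj.le.trans (strictFloor_mono hαβ))
    rw [rpow_mul_root_pow hκ h] at h1
    have h2 := hf.le_of_eq_zero (by linarith) hx hy h0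
    calc _ ≤ C * (κ ^ (j / β) * f y ^ (α - j / β)) := h1
      _ ≤ C * (κ ^ (j / β) * (κ * |y - x| ^ β) ^ (α - j / β)) := by gcongr
      _ = C * (κ ^ (j / β) * κ ^ (α - j / β)) * |y - x| ^ (α * β - j) := by
        rw [Real.mul_rpow hκ (by positivity), ← Real.rpow_mul (abs_nonneg _),
          show β * (α - j / β) = α * β - j by field_simp]
        ring

theorem der_rpow_eq_zero (hf : FlatBounds β κ M f) {α : ℝ} (hα : 0 < α) (hα1 : α ≤ 1) {j : ℕ}
    (hj : j ≤ strictFloor (α * β)) :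
    ∀ x ∈ Icc (0 : ℝ) 1, f x = 0 → der j (fun z => f z ^ α) x = 0 := by
  induction j with
  | zero => intro x _ h; simp [der, h, Real.zero_rpow hα.ne']
  | succ j ih =>
    intro x hx h
    have ih' := ih (by omega)
    rw [der, iteratedDerivWithin_succ]
    exact (hf.hasDerivWithinAt_der_rpow_zero hα hα1 hx h (by omega) (ih' x hx h)
      ih').derivWithin (uniqueDiffOn_unitInterval x hx)

theorem derExists_rpow (hf : FlatBounds β κ M f) {α : ℝ} (hα : 0 < α) (hα1 : α ≤ 1) :
    DerExists (strictFloor (α * β)) (fun z => f z ^ α) := by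
  intro j hj x hx
  have hβ := hf.pos_exponent
  rcases (hf.nonneg x hx).eq_or_lt with h | h
  · have hz := hf.der_rpow_eq_zero hα hα1 hj.le
    exact (hf.hasDerivWithinAt_der_rpow_zero hα hα1 hx h.symm hj (hz x hx h.symm)
      hz).differentiableWithinAt
  · exact hf.differentiableWithinAt_der_rpow α hx h
      (hj.trans_le (strictFloor_mono (by nlinarith)))

/-- Global estimate for the derivatives of `f ^ α` up to order `⌊αβ⌋`. -/
theorem exists_abs_der_rpow_le_rpow {α β : ℝ} (hα : 0 < α) (hα1 : α ≤ 1) :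
    ∃ C : ℝ, 1 ≤ C ∧ ∀ (κ M : ℝ) (f : ℝ → ℝ), FlatBounds β κ M f →
      ∀ x ∈ Icc (0 : ℝ) 1, ∀ n ≤ strictFloor (α * β),
        |der n (fun z => f z ^ α) x| ≤ C * (κ ^ (n / β) * f x ^ (α - n / β)) := by
  obtain ⟨C, hC1, hC⟩ := exists_abs_der_rpow_le α β
  refine ⟨C, hC1, fun κ M f hf x hx n hn => ?_⟩
  have hβ := hf.pos_exponent
  have hκ := hf.flat_nonneg
  rcases (hf.nonneg x hx).eq_or_lt with h | h
  · rw [hf.der_rpow_eq_zero hα hα1 hn x hx h.symm, abs_zero]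
    have := hf.nonneg x hx
    positivity
  · have h1 := hC κ M f hf x hx h n (hn.trans (strictFloor_mono (by nlinarith)))
    rwa [rpow_mul_root_pow hκ h] at h1

/-- Hölder estimate at points where `f` is large compared with their distance, when `f ^ α` has
one more derivative than needed. -/
theorem abs_der_sub_le_of_lt (hf : FlatBounds β κ M f) {α C : ℝ} (hα : 0 < α)
    (hM : 0 < M) (hC0 : 0 ≤ C)
    (hC : ∀ x ∈ Icc (0 : ℝ) 1, 0 < f x → ∀ n ≤ strictFloor β,
      |der n (fun z => f z ^ α) x| ≤ C * (f x ^ α * ((κ / f x) ^ (1 / β)) ^ n))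
    (hl : strictFloor (α * β) < strictFloor β) {x y : ℝ} (hx : x ∈ Icc (0 : ℝ) 1)
    (hy : y ∈ Icc (0 : ℝ) 1) (hxy : x ≠ y)
    (hbig : 2 ^ (β + 1) * (M * |x - y| ^ β) ≤ f x) :
    |der (strictFloor (α * β)) (fun z => f z ^ α) x -
      der (strictFloor (α * β)) (fun z => f z ^ α) y| ≤
      C * M ^ α * |x - y| ^ (α * β - strictFloor (α * β)) := by
  have hβ := hf.pos_exponent
  have hκ := hf.flat_nonneg
  set l := strictFloor (α * β) with hldef
  set h := |x - y| with hh
  have hh0 : 0 < h := abs_pos.2 (sub_ne_zero.2 hxy)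
  have hsub : uIcc x y ⊆ Icc (0 : ℝ) 1 := ordConnected_Icc.uIcc_subset hx hy
  have hT : 0 < M * h ^ β := by positivity
  have hlow : ∀ z ∈ uIcc x y, M * h ^ β ≤ f z := by
    intro z hz
    have hd : |x - z| ≤ h := by
      rw [hh, abs_sub_comm x z, abs_sub_comm x y]
      exact abs_sub_left_of_mem_uIcc hz
    have h1 := (hf.comparable hM hx (hsub hz) hd hbig).1
    have h2 : (0 : ℝ) < 2 ^ (β + 1) := by positivity
    exact le_of_mul_le_mul_left (hbig.trans h1) h2
  -- As `αβ ≤ l + 1`, the exponent of `f` is nonpositive, so the lower bound on `f` bounds the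
  -- derivative of order `l + 1` from above.
  have hexp : α - (l + 1 : ℕ) / β ≤ 0 := by
    rw [sub_nonpos, le_div_iff₀ hβ]
    push_cast
    exact (strictFloor_spec (mul_pos hα hβ)).2
  have hmvt := Convex.norm_image_sub_le_of_norm_hasDerivWithin_le (s := uIcc x y)
    (f := der l fun z => f z ^ α) (f' := der (l + 1) fun z => f z ^ α)
    (C := C * (M ^ α * h ^ (α * β - (l + 1 : ℕ)))) (fun z hz => ?_) (fun z hz => ?_)
    (convex_uIcc x y) right_mem_uIcc left_mem_uIcc
  · refine hmvt.trans_eq ?_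
    have h3 : h ^ (α * β - l) = h ^ (α * β - (l + 1 : ℕ)) * h := by
      rw [← Real.rpow_add_one hh0.ne']
      congr 1; push_cast; ring
    rw [h3, Real.norm_eq_abs]
    ring
  · have h1 := (hf.differentiableWithinAt_der_rpow α (hsub hz) (hT.trans_le (hlow z hz))
      hl).hasDerivWithinAt.mono hsub
    change HasDerivWithinAt _ (iteratedDerivWithin (l + 1) _ _ z) _ _
    rw [iteratedDerivWithin_succ]
    exact h1
  · have hz0 := hT.trans_le (hlow z hz)
    have h1 := hC z (hsub hz) hz0 (l + 1) hl
    rw [rpow_mul_root_pow hκ hz0] at h1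
    refine h1.trans ?_
    rw [← rpow_mul_mul_rpow hβ hM hh0.le]
    gcongr C * (?_ * ?_)
    · exact Real.rpow_le_rpow hκ hf.flat_le (by positivity)
    · exact Real.rpow_le_rpow_of_nonpos hT (hlow z hz) hexp

/-- Hölder estimate at points where `f` is large compared with their distance, when `⌊αβ⌋ = ⌊β⌋`. -/
theorem exists_abs_der_sub_le_of_eq {α β : ℝ} (hα1 : α ≤ 1) :
    ∃ C : ℝ, 0 ≤ C ∧ ∀ (κ M : ℝ) (f : ℝ → ℝ), FlatBounds β κ M f → 0 < M →
      ∀ x ∈ Icc (0 : ℝ) 1, ∀ y ∈ Icc (0 : ℝ) 1, x ≠ y →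
      2 ^ (β + 1) * (M * |x - y| ^ β) ≤ f x →
      |der (strictFloor β) (fun z => f z ^ α) x - der (strictFloor β) (fun z => f z ^ α) y| ≤
        C * M ^ α * |x - y| ^ (α * β - strictFloor β) := by
  rcases le_or_gt β 0 with hβ | hβ
  · exact ⟨0, le_rfl, fun κ M f hf => absurd hf.pos_exponent hβ.not_gt⟩
  set b : ℝ := 2 ^ (β + 1) with hb
  have hb1 : 1 ≤ b := Real.one_le_rpow one_le_two (by linarith)
  have hb0 : 0 < b := by linarith
  set k := strictFloor β with hk
  have hkβ := strictFloor_spec hβ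
  obtain ⟨C, hC0, hC⟩ := exists_iteratedDerivWithin_rpow_bound hb1 k α
  refine ⟨C * b ^ (k + 1), by positivity, ?_⟩
  intro κ M f hf hM x hx y hy hxy hbig
  have hκ := hf.flat_nonneg
  set h := |x - y| with hh
  have hh0 : 0 < h := abs_pos.2 (sub_ne_zero.2 hxy)
  have hT : 0 < M * h ^ β := by positivity
  have hTx : M * h ^ β ≤ f x := le_trans (le_mul_of_one_le_left hT.le hb1) hbig
  have hfx : 0 < f x := hT.trans_le hTx
  have hsub : uIcc x y ⊆ Icc (0 : ℝ) 1 := ordConnected_Icc.uIcc_subset hx hy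
  have hcomp : ∀ z ∈ uIcc x y, f x ≤ b * f z ∧ f z ≤ b * f x := by
    intro z hz
    refine hf.comparable hM hx (hsub hz) ?_ hbig
    rw [hh, abs_sub_comm x z, abs_sub_comm x y]
    exact abs_sub_left_of_mem_uIcc hz
  have hpos : ∀ z ∈ uIcc x y, 0 < f z := fun z hz =>
    pos_of_mul_pos_right (hfx.trans_le (hcomp z hz).1) hb0.le
  -- Inverse length scale of `f` at `x`, with `M` in place of `κ` so that it also governs the Hölder
  -- bound. Largeness of `f x` amounts to `D₀ * h ≤ 1`.
  set D₀ := (M / f x) ^ (1 / β) with hD₀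
  have hD₀0 : 0 < D₀ := by positivity
  have hD₀β : D₀ ^ β = M / f x := by
    rw [hD₀, ← Real.rpow_mul (by positivity), one_div_mul_cancel hβ.ne', Real.rpow_one]
  have hDh : D₀ * h ≤ 1 := by
    have h1 : (D₀ * h) ^ β ≤ 1 ^ β := by
      rw [Real.mul_rpow hD₀0.le hh0.le, hD₀β, Real.one_rpow, div_mul_eq_mul_div]
      exact (div_le_one hfx).2 hTx
    exact (Real.rpow_le_rpow_iff (by positivity) zero_le_one hβ).1 h1
  have hder : ∀ z ∈ uIcc x y, ∀ i, 1 ≤ i → i ≤ k →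
      |iteratedDerivWithin i (fun w => (f x)⁻¹ * f w) (Icc 0 1) z| ≤ (b * D₀) ^ i := by
    intro z hz i hi1 hi
    have hiβ : (i : ℝ) ≤ β := by
      have : (i : ℝ) ≤ k := by exact_mod_cast hi
      linarith
    have hz0 := hpos z hz
    rw [iteratedDerivWithin_const_mul_field, abs_mul, abs_of_pos (inv_pos.2 hfx),
      inv_mul_le_iff₀ hfx]
    have h1 := hf.der_le z (hsub hz) hz0 i hi
    have h2 := rpow_mul_root_pow (α := 1) (β := β) hκ hz0 i
    have h3 := rpow_mul_root_pow (α := 1) (β := β) hM.le hfx i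
    rw [Real.rpow_one] at h2 h3
    have he0 : 0 ≤ 1 - i / β := by rw [sub_nonneg, div_le_one hβ]; exact hiβ
    have he1 : 1 - i / β ≤ 1 := by
      have : 0 ≤ i / β := by positivity
      linarith
    calc |der i f z| ≤ κ ^ (i / β) * f z ^ (1 - i / β) := h1.trans_eq h2
      _ ≤ M ^ (i / β) * (b * f x) ^ (1 - i / β) := by
        gcongr
        · exact hf.flat_le
        · exact (hcomp z hz).2
      _ = b ^ (1 - i / β) * (f x * D₀ ^ i) := by
        rw [h3, Real.mul_rpow hb0.le hfx.le]; ring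
      _ ≤ b ^ i * (f x * D₀ ^ i) := by
        gcongr
        calc b ^ (1 - i / β) ≤ b ^ (1 : ℝ) := Real.rpow_le_rpow_of_exponent_le hb1 he1
          _ = b ^ 1 := by simp
          _ ≤ b ^ i := pow_le_pow_right₀ hb1 hi1
      _ = f x * (b * D₀) ^ i := by rw [mul_pow]; ring
  have hmem : ∀ z ∈ uIcc x y, (f x)⁻¹ * f z ∈ Icc b⁻¹ b := by
    intro z hz
    have := hcomp z hz
    constructor
    · rw [inv_mul_eq_div, le_div_iff₀ hfx, inv_mul_le_iff₀ hb0]; exact this.1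
    · rw [inv_mul_le_iff₀ hfx, mul_comm]; exact this.2
  -- At order `k` this is the rescaled Hölder bound. Below it, the mean value theorem gives the
  -- factor `D₀ * h`, which is at most `(D₀ * h) ^ (β - k)` since `D₀ * h ≤ 1` and `β - k ≤ 1`.
  set δ := b * (D₀ * h) ^ (β - k) with hδ
  have hexp0 : 0 ≤ β - k := by linarith
  have hdiff : ∀ i ≤ k, |iteratedDerivWithin i (fun w => (f x)⁻¹ * f w) (Icc 0 1) x -
      iteratedDerivWithin i (fun w => (f x)⁻¹ * f w) (Icc 0 1) y| ≤ δ * (b * D₀) ^ i := by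
    intro i hi
    rcases hi.eq_or_lt with rfl | hi
    · rw [iteratedDerivWithin_const_mul_field, iteratedDerivWithin_const_mul_field, ← mul_sub,
        abs_mul, abs_of_pos (inv_pos.2 hfx), inv_mul_le_iff₀ hfx]
      refine (hf.holder x hx y hy).trans ?_
      have h1 : M = f x * (D₀ ^ (β - k) * D₀ ^ k) := by
        rw [← Real.rpow_add_natCast hD₀0.ne', sub_add_cancel, hD₀β]; field_simp
      have h2 : (1 : ℝ) ≤ b * b ^ k := one_le_mul_of_one_le_of_one_le hb1 (one_le_pow₀ hb1)
      calc M * h ^ (β - k) = 1 * (f x * (D₀ ^ (β - k) * D₀ ^ k) * h ^ (β - k)) := by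
            rw [one_mul, ← h1]
        _ ≤ (b * b ^ k) * (f x * (D₀ ^ (β - k) * D₀ ^ k) * h ^ (β - k)) := by gcongr
        _ = f x * (δ * (b * D₀) ^ k) := by
            rw [hδ, Real.mul_rpow hD₀0.le hh0.le, mul_pow]; ring
    · have hmvt := Convex.norm_image_sub_le_of_norm_hasDerivWithin_le (s := uIcc x y)
        (f := iteratedDerivWithin i (fun w => (f x)⁻¹ * f w) (Icc 0 1))
        (f' := iteratedDerivWithin (i + 1) (fun w => (f x)⁻¹ * f w) (Icc 0 1))
        (C := (b * D₀) ^ (i + 1)) (fun z hz => ?_) (fun z hz => hder z hz (i + 1) (by omega) hi)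
        (convex_uIcc x y) right_mem_uIcc left_mem_uIcc
      · refine hmvt.trans ?_
        rw [Real.norm_eq_abs, ← hh, pow_succ]
        have h1 : D₀ * h ≤ (D₀ * h) ^ (β - k) := by
          simpa using Real.rpow_le_rpow_of_exponent_ge (by positivity : 0 < D₀ * h) hDh
            (by linarith : β - k ≤ 1)
        calc (b * D₀) ^ i * (b * D₀) * h = (b * D₀) ^ i * (b * (D₀ * h)) := by ring
          _ ≤ (b * D₀) ^ i * (b * (D₀ * h) ^ (β - k)) := by gcongr
          _ = δ * (b * D₀) ^ i := by rw [hδ]; ring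
      · have h1 := (ContDiffOn.differentiableOn_iteratedDerivWithin (m := i)
          ((contDiffOn_const (c := (f x)⁻¹)).mul hf.contDiffOn) (by exact_mod_cast hi)
          uniqueDiffOn_unitInterval z (hsub hz)).hasDerivWithinAt.mono hsub
        rwa [← iteratedDerivWithin_succ] at h1
  have hmain := (hC (Icc 0 1) (fun z => (f x)⁻¹ * f z) x y (b * D₀) δ uniqueDiffOn_unitInterval
    (contDiffOn_const.mul hf.contDiffOn) hx hy (hmem x left_mem_uIcc) (hmem y right_mem_uIcc)
    (by positivity) (by positivity) (hder x left_mem_uIcc) (hder y right_mem_uIcc) hdiff).2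
  rw [hf.der_rpow_div α hfx hx, hf.der_rpow_div α hfx hy, ← mul_sub, abs_mul,
    abs_of_pos (by positivity), inv_mul_le_iff₀ (by positivity)] at hmain
  refine hmain.trans ?_
  have h1 : D₀ ^ (β - k) * D₀ ^ k = M / f x := by
    rw [← Real.rpow_add_natCast hD₀0.ne', sub_add_cancel, hD₀β]
  -- Here `α ≤ 1` enters: the power is decreasing in `f x`.
  have h2 : f x ^ (α - 1) ≤ (M * h ^ β) ^ (α - 1) :=
    Real.rpow_le_rpow_of_nonpos hT hTx (by linarith)
  have h3 : M * (M * h ^ β) ^ (α - 1) * h ^ (β - k) = M ^ α * h ^ (α * β - k) := by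
    rw [Real.mul_rpow hM.le (by positivity), ← Real.rpow_mul hh0.le, ← mul_assoc, mul_comm M,
      ← Real.rpow_add_one hM.ne', mul_assoc, ← Real.rpow_add hh0]
    congr 2 <;> ring
  calc f x ^ α * (C * δ * (b * D₀) ^ k)
      = C * b ^ (k + 1) * (f x ^ α * (D₀ ^ (β - k) * D₀ ^ k) * h ^ (β - k)) := by
        rw [hδ, Real.mul_rpow hD₀0.le hh0.le, mul_pow]; ring
    _ = C * b ^ (k + 1) * (M * f x ^ (α - 1) * h ^ (β - k)) := by
        rw [h1, Real.rpow_sub_one hfx.ne']; ring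
    _ ≤ C * b ^ (k + 1) * (M * (M * h ^ β) ^ (α - 1) * h ^ (β - k)) := by gcongr
    _ = C * b ^ (k + 1) * M ^ α * h ^ (α * β - k) := by rw [h3]; ring

/-- The derivative of `f ^ α` of order `⌊αβ⌋` is Hölder continuous. -/
theorem exists_abs_der_rpow_sub_le {α β : ℝ} (hα : 0 < α) (hα1 : α ≤ 1) (hβ : 0 < β) :
    ∃ C : ℝ, 0 ≤ C ∧ ∀ (κ M : ℝ) (f : ℝ → ℝ), FlatBounds β κ M f → 0 < M →
      ∀ x ∈ Icc (0 : ℝ) 1, ∀ y ∈ Icc (0 : ℝ) 1,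
      |der (strictFloor (α * β)) (fun z => f z ^ α) x -
        der (strictFloor (α * β)) (fun z => f z ^ α) y| ≤
        C * M ^ α * |x - y| ^ (α * β - strictFloor (α * β)) := by
  obtain ⟨C₁, hC₁1, hC₁⟩ := exists_abs_der_rpow_le α β
  obtain ⟨C₂, hC₂1, hC₂⟩ := exists_abs_der_rpow_le_rpow (β := β) hα hα1
  obtain ⟨C₃, hC₃0, hC₃⟩ := exists_abs_der_sub_le_of_eq (β := β) hα1
  set l := strictFloor (α * β) with hl
  set b : ℝ := 2 ^ (β + 1) with hb
  have hb0 : 0 < b := by positivity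
  set C₄ : ℝ := 2 * (C₂ * b ^ (α - l / β)) with hC₄
  have hC₄0 : 0 ≤ C₄ := by positivity
  refine ⟨C₁ + C₃ + C₄, by positivity, ?_⟩
  intro κ M f hf hM
  have hκ := hf.flat_nonneg
  have hlk : l ≤ strictFloor β := strictFloor_mono (by nlinarith)
  have hlβ := (strictFloor_spec (mul_pos hα hβ)).1
  have hlarge : ∀ x ∈ Icc (0 : ℝ) 1, ∀ y ∈ Icc (0 : ℝ) 1, x ≠ y →
      b * (M * |x - y| ^ β) ≤ f x →
      |der l (fun z => f z ^ α) x - der l (fun z => f z ^ α) y| ≤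
        (C₁ + C₃ + C₄) * M ^ α * |x - y| ^ (α * β - l) := by
    intro x hx y hy hxy hbig
    rcases hlk.lt_or_eq with h | h
    · refine (hf.abs_der_sub_le_of_lt hα hM (by linarith) (hC₁ κ M f hf) h hx hy hxy hbig).trans ?_
      gcongr
      linarith
    · have := hC₃ κ M f hf hM x hx y hy hxy hbig
      rw [← h] at this
      refine this.trans ?_
      gcongr
      linarith
  intro x hx y hy
  rcases eq_or_ne x y with rfl | hxy
  · rw [sub_self, abs_zero]; positivity
  by_cases hbx : b * (M * |x - y| ^ β) ≤ f x
  · exact hlarge x hx y hy hxy hbx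
  by_cases hby : b * (M * |y - x| ^ β) ≤ f y
  · rw [abs_sub_comm, abs_sub_comm x y]
    exact hlarge y hy x hx hxy.symm hby
  rw [abs_sub_comm y x] at hby
  push Not at hbx hby
  have hexp : 0 ≤ α - l / β := by rw [sub_nonneg, div_le_iff₀ hβ]; exact hlβ.le
  have hsmall : ∀ z ∈ Icc (0 : ℝ) 1, f z < b * (M * |x - y| ^ β) →
      |der l (fun z => f z ^ α) z| ≤
        C₂ * b ^ (α - l / β) * (M ^ α * |x - y| ^ (α * β - l)) := by
    intro z hz hfz
    have hz0 := hf.nonneg z hz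
    calc _ ≤ C₂ * (κ ^ (l / β) * f z ^ (α - l / β)) := hC₂ κ M f hf z hz l le_rfl
      _ ≤ C₂ * (M ^ (l / β) * (b * (M * |x - y| ^ β)) ^ (α - l / β)) := by
        gcongr
        exact hf.flat_le
      _ = C₂ * b ^ (α - l / β) * (M ^ (l / β) * (M * |x - y| ^ β) ^ (α - l / β)) := by
        rw [Real.mul_rpow hb0.le (by positivity)]; ring
      _ = _ := by rw [rpow_mul_mul_rpow hβ hM (abs_nonneg _)]
  calc _ ≤ |der l (fun z => f z ^ α) x| + |der l (fun z => f z ^ α) y| := abs_sub _ _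
    _ ≤ C₄ * (M ^ α * |x - y| ^ (α * β - l)) := by
      rw [hC₄]; linarith [hsmall x hx hbx, hsmall y hy hby]
    _ ≤ (C₁ + C₃ + C₄) * (M ^ α * |x - y| ^ (α * β - l)) := by gcongr; linarith
    _ = _ := by ring

end FlatBounds

/-! ### Passing between extended norms and real inequalities -/

/-- The infimum is attained because the condition is closed in `κ`. -/
theorem isFlat_toNNReal_flatSeminorm {β : ℝ} {f : ℝ → ℝ} (hf : flatSeminorm β f < ∞) :
    IsFlat β f (flatSeminorm β f).toNNReal := by
  intro x hx j hj hjβ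
  set κ₀ := (flatSeminorm β f).toNNReal with hκ₀
  have hκ : ((κ₀ : ℝ≥0) : ℝ≥0∞) = flatSeminorm β f := ENNReal.coe_toNNReal hf.ne
  have h1 : ∀ κ : ℝ≥0, κ₀ < κ →
      |der j f x| ^ β ≤ (κ : ℝ) ^ j * |f x| ^ (β - j) := by
    intro κ h
    have h2 : flatSeminorm β f < κ := by rw [← hκ]; exact_mod_cast h
    simp only [flatSeminorm, iInf_lt_iff] at h2
    obtain ⟨κ', hflat, hlt⟩ := h2
    refine (hflat x hx j hj hjβ).trans ?_
    have : (κ' : ℝ) ≤ κ := by exact_mod_cast hlt.le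
    gcongr
  have hc : Continuous fun κ : ℝ≥0 => (κ : ℝ) ^ j * |f x| ^ (β - j) := by fun_prop
  exact ge_of_tendsto (hc.continuousWithinAt (s := Ioi κ₀))
    (eventually_nhdsWithin_of_forall fun κ hκ => h1 κ hκ)

theorem flatSeminorm_le {β : ℝ} {f : ℝ → ℝ} {κ : ℝ≥0} (h : IsFlat β f κ) :
    flatSeminorm β f ≤ κ := iInf₂_le κ h

theorem supNorm_le {f : ℝ → ℝ} {K : ℝ} (h : ∀ x ∈ Icc (0 : ℝ) 1, |f x| ≤ K) :
    supNorm f ≤ ENNReal.ofReal K :=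
  iSup₂_le fun x hx => by
    rw [Real.enorm_eq_ofReal_abs]; exact ENNReal.ofReal_le_ofReal (h x hx)

theorem abs_le_of_supNorm_le {f : ℝ → ℝ} {K : ℝ} (hK : 0 ≤ K) (h : supNorm f ≤ ENNReal.ofReal K)
    {x : ℝ} (hx : x ∈ Icc (0 : ℝ) 1) : |f x| ≤ K := by
  have h1 : ‖f x‖ₑ ≤ supNorm f := le_iSup₂_of_le x hx le_rfl
  rw [Real.enorm_eq_ofReal_abs] at h1
  exact (ENNReal.ofReal_le_ofReal_iff hK).1 (h1.trans h)

theorem holderSeminorm_le {β : ℝ} {f : ℝ → ℝ} {K : ℝ} (hK : 0 ≤ K)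
    (h : ∀ x ∈ Icc (0 : ℝ) 1, ∀ y ∈ Icc (0 : ℝ) 1,
      |der (strictFloor β) f x - der (strictFloor β) f y| ≤ K * |x - y| ^ (β - strictFloor β)) :
    holderSeminorm β f ≤ ENNReal.ofReal K := by
  refine iSup₂_le fun x hx => iSup₂_le fun y hy => iSup_le fun hxy => ?_
  refine ENNReal.div_le_of_le_mul ?_
  rw [← ENNReal.ofReal_mul hK, Real.enorm_eq_ofReal_abs]
  exact ENNReal.ofReal_le_ofReal (h x hx y hy)

theorem abs_der_sub_le_of_holderSeminorm_le {β : ℝ} {f : ℝ → ℝ} {K : ℝ} (hK : 0 ≤ K)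
    (h : holderSeminorm β f ≤ ENNReal.ofReal K) {x y : ℝ} (hx : x ∈ Icc (0 : ℝ) 1)
    (hy : y ∈ Icc (0 : ℝ) 1) :
    |der (strictFloor β) f x - der (strictFloor β) f y| ≤ K * |x - y| ^ (β - strictFloor β) := by
  rcases eq_or_ne x y with rfl | hxy
  · rw [sub_self, abs_zero]; positivity
  have hpos : 0 < |x - y| ^ (β - strictFloor β) :=
    Real.rpow_pos_of_pos (abs_pos.2 (sub_ne_zero.2 hxy)) _
  have h1 : ‖der (strictFloor β) f x - der (strictFloor β) f y‖ₑ /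
      ENNReal.ofReal (|x - y| ^ (β - strictFloor β)) ≤ holderSeminorm β f :=
    le_iSup₂_of_le x hx (le_iSup₂_of_le y hy (le_iSup_of_le hxy le_rfl))
  have h2 := (ENNReal.div_le_iff_le_mul (.inl (ENNReal.ofReal_pos.2 hpos).ne')
    (.inl ENNReal.ofReal_ne_top)).1 (h1.trans h)
  rw [← ENNReal.ofReal_mul hK, Real.enorm_eq_ofReal_abs] at h2
  exact (ENNReal.ofReal_le_ofReal_iff (by positivity)).1 h2

theorem continuousOn_of_abs_sub_le {G : ℝ → ℝ} {S : Set ℝ} {K γ : ℝ} (hγ : 0 < γ)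
    (h : ∀ x ∈ S, ∀ y ∈ S, |G x - G y| ≤ K * |x - y| ^ γ) : ContinuousOn G S := by
  intro y hy
  refine tendsto_iff_norm_sub_tendsto_zero.2 ?_
  have hc : ContinuousAt (fun x => K * |x - y| ^ γ) y :=
    continuousAt_const.mul (ContinuousAt.rpow_const (by fun_prop) (.inr hγ.le))
  have h0 := hc.tendsto
  simp only [sub_self, abs_zero, Real.zero_rpow hγ.ne', mul_zero] at h0
  exact squeeze_zero' (Eventually.of_forall fun _ => norm_nonneg _)
    (eventually_nhdsWithin_of_forall fun x hx => h x hx y hy) (h0.mono_left nhdsWithin_le_nhds)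

theorem abs_le_mul_root_pow {β κ s d : ℝ} (hβ : 0 < β) (hκ : 0 ≤ κ) (hs : 0 < s) {j : ℕ}
    (h : |d| ^ β ≤ κ ^ j * s ^ (β - j)) : |d| ≤ s * ((κ / s) ^ (1 / β)) ^ j := by
  refine (Real.rpow_le_rpow_iff (abs_nonneg _) (by positivity) hβ).1 (h.trans_eq ?_)
  rw [Real.mul_rpow hs.le (by positivity), ← Real.rpow_natCast, ← Real.rpow_natCast,
    ← Real.rpow_mul (by positivity), ← Real.rpow_mul (by positivity),
    show 1 / β * (j * β) = j by field_simp, Real.div_rpow hκ hs.le, Real.rpow_sub hs]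
  have := Real.rpow_pos_of_pos hs j
  field_simp

theorem flatBounds_of_mem_holderCone {β M : ℝ} (hβ : 0 < β) (hM : 0 ≤ M) {f : ℝ → ℝ}
    (hf : f ∈ holderCone β) (h : coneNorm β f ≤ ENNReal.ofReal M) :
    FlatBounds β (flatSeminorm β f).toNNReal M f := by
  obtain ⟨⟨hder, -⟩, hnn, hfin⟩ := hf
  have hflat : flatSeminorm β f ≤ coneNorm β f := le_add_self
  have hsemi : holderSeminorm β f ≤ coneNorm β f := le_add_right le_add_self
  have hk := strictFloor_spec hβ
  have hIsFlat := isFlat_toNNReal_flatSeminorm (hflat.trans_lt hfin)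
  have hhol := fun x (hx : x ∈ Icc (0 : ℝ) 1) y (hy : y ∈ Icc (0 : ℝ) 1) =>
    abs_der_sub_le_of_holderSeminorm_le hM (hsemi.trans h) hx hy
  refine ⟨hβ, NNReal.coe_nonneg _, ?_, ?_, hnn, ?_, ?_, hhol⟩
  · exact ENNReal.toReal_le_of_le_ofReal hM (hflat.trans h)
  · refine contDiffOn_of_continuousOn_differentiableOn_deriv (n := (strictFloor β : ℕ∞))
      (fun m hm => ?_) (fun m hm => hder m (by exact_mod_cast hm))
    have hm' : m ≤ strictFloor β := by exact_mod_cast hm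
    rcases hm'.lt_or_eq with hlt | rfl
    · exact (hder m hlt).continuousOn
    -- Continuity of the top derivative comes from its Hölder bound, as `β - ⌊β⌋ > 0`.
    · exact continuousOn_of_abs_sub_le (by linarith) hhol
  · intro x hx hfx j hj
    rcases Nat.eq_zero_or_pos j with rfl | hj0
    · simp [der, abs_of_pos hfx]
    · refine abs_le_mul_root_pow hβ (NNReal.coe_nonneg _) hfx ?_
      have hj' : (j : ℝ) ≤ strictFloor β := by exact_mod_cast hj
      simpa only [abs_of_pos hfx] using hIsFlat x hx j hj0 (by linarith)
  · intro x hx hfx j hj0 hj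
    have hj' : (j : ℝ) ≤ strictFloor β := by exact_mod_cast hj
    have h1 := hIsFlat x hx j hj0 (by linarith)
    rw [hfx, abs_zero, Real.zero_rpow (by linarith), mul_zero] at h1
    have h2 := le_antisymm h1 (by positivity)
    rw [Real.rpow_eq_zero (abs_nonneg _) hβ.ne'] at h2
    exact abs_eq_zero.1 h2

theorem le_of_coneNorm_le {β M : ℝ} (hM : 0 ≤ M) {f : ℝ → ℝ}
    (h : coneNorm β f ≤ ENNReal.ofReal M) {x : ℝ} (hx : x ∈ Icc (0 : ℝ) 1) : f x ≤ M := by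
  have hsup : supNorm f ≤ coneNorm β f := le_add_right (le_add_right le_self_add)
  exact (le_abs_self _).trans (abs_le_of_supNorm_le hM (hsup.trans h) hx)

/-- Lets estimates be proved for positive real `M` only; letting `M` decrease to `N` includes `N =
0`. -/
theorem le_mul_rpow_of_forall_pos {X N : ℝ≥0∞} {C α : ℝ} (hα : 0 < α) (hC : 0 ≤ C) (hN : N < ∞)
    (h : ∀ M : ℝ, 0 < M → N ≤ ENNReal.ofReal M → X ≤ ENNReal.ofReal (C * M ^ α)) :
    X ≤ C.toNNReal * N ^ α := by
  have hc : ContinuousAt (fun M : ℝ => ENNReal.ofReal (C * M ^ α)) N.toReal :=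
    ENNReal.continuous_ofReal.continuousAt.comp
      (continuousAt_const.mul (continuousAt_id.rpow_const (.inr hα.le)))
  have h1 : X ≤ ENNReal.ofReal (C * N.toReal ^ α) := by
    refine ge_of_tendsto (hc.tendsto.mono_left nhdsWithin_le_nhds :
      Tendsto _ (𝓝[>] N.toReal) _) (eventually_nhdsWithin_of_forall fun M hM => ?_)
    exact h M (ENNReal.toReal_nonneg.trans_lt hM)
      ((ENNReal.le_ofReal_iff_toReal_le hN.ne (ENNReal.toReal_nonneg.trans hM.le)).2 hM.le)
  refine h1.trans_eq ?_
  rw [ENNReal.ofReal_mul hC, ← ENNReal.ofReal_rpow_of_nonneg ENNReal.toReal_nonneg hα.le,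
    ENNReal.ofReal_toReal hN.ne]
  rfl

/-! ### Norm estimates for `f ^ α` -/

section Estimates

variable {α β : ℝ}

theorem supNorm_rpow_le (hα : 0 < α) {f : ℝ → ℝ} (hf : f ∈ holderCone β) {M : ℝ} (hM : 0 < M)
    (h : coneNorm β f ≤ ENNReal.ofReal M) :
    supNorm (fun x => f x ^ α) ≤ ENNReal.ofReal (M ^ α) := by
  refine supNorm_le fun x hx => ?_
  have h0 := hf.2.1 x hx
  rw [abs_of_nonneg (by positivity)]
  exact Real.rpow_le_rpow h0 (le_of_coneNorm_le hM.le h hx) hα.le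

theorem exists_supNorm_der_rpow_le (hα : 0 < α) (hα1 : α ≤ 1) (hβ : 0 < β) :
    ∃ C : ℝ, 0 ≤ C ∧ ∀ f ∈ holderCone β, ∀ M : ℝ, 0 < M → coneNorm β f ≤ ENNReal.ofReal M →
      supNorm (der (strictFloor (α * β)) fun x => f x ^ α) ≤ ENNReal.ofReal (C * M ^ α) := by
  obtain ⟨C, hC1, hC⟩ := FlatBounds.exists_abs_der_rpow_le_rpow (β := β) hα hα1
  refine ⟨C, by linarith, fun f hf M hM h => supNorm_le fun x hx => ?_⟩
  have hfb := flatBounds_of_mem_holderCone hβ hM.le hf h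
  have hx0 := hfb.nonneg x hx
  set l := strictFloor (α * β)
  have hexp : 0 ≤ α - l / β := by
    rw [sub_nonneg, div_le_iff₀ hβ]; exact (strictFloor_spec (mul_pos hα hβ)).1.le
  refine (hC _ M f hfb x hx l le_rfl).trans ?_
  calc _ ≤ C * (M ^ (l / β) * M ^ (α - l / β)) := by
        gcongr
        · exact hfb.flat_le
        · exact le_of_coneNorm_le hM.le h hx
    _ = C * M ^ α := by rw [← Real.rpow_add hM]; congr 2; ring

theorem exists_flatSeminorm_rpow_le (hα : 0 < α) (hα1 : α ≤ 1) (hβ : 0 < β) :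
    ∃ C : ℝ≥0, ∀ f ∈ holderCone β,
      flatSeminorm (α * β) (fun x => f x ^ α) ≤ C * flatSeminorm β f ^ α := by
  obtain ⟨C, hC1, hC⟩ := FlatBounds.exists_abs_der_rpow_le_rpow (β := β) hα hα1
  have hαβ : 0 < α * β := mul_pos hα hβ
  have hC0 : 0 ≤ C := by linarith
  refine ⟨(C ^ (α * β)).toNNReal, fun f hf => ?_⟩
  have hfin := hf.2.2
  have hfl : flatSeminorm β f < ∞ := lt_of_le_of_lt le_add_self hfin
  have hfb := flatBounds_of_mem_holderCone hβ ENNReal.toReal_nonneg hf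
    (ENNReal.ofReal_toReal hfin.ne).ge
  set κ := (flatSeminorm β f).toNNReal with hκ
  have hflat : IsFlat (α * β) (fun x => f x ^ α) ((C ^ (α * β)).toNNReal * κ ^ α) := by
    intro x hx j hj hjβ
    have hx0 := hfb.nonneg x hx
    have hκ0 : (0 : ℝ) ≤ κ := κ.2
    have hexp : 0 ≤ α - j / β := by rw [sub_nonneg, div_le_iff₀ hβ]; exact hjβ.le
    have h1 := hC _ _ f hfb x hx j (natCast_le_strictFloor hjβ)
    have hCp : 1 ≤ C ^ (α * β) := Real.one_le_rpow hC1 hαβ.le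
    push_cast
    rw [Real.coe_toNNReal _ (by positivity), abs_of_nonneg (by positivity : 0 ≤ f x ^ α)]
    calc _ ≤ (C * ((κ : ℝ) ^ (j / β) * f x ^ (α - j / β))) ^ (α * β) := by gcongr
      _ = C ^ (α * β) * (((κ : ℝ) ^ α) ^ j * (f x ^ α) ^ (α * β - j)) := by
        rw [Real.mul_rpow hC0 (by positivity), Real.mul_rpow (by positivity) (by positivity),
          ← Real.rpow_mul hκ0, ← Real.rpow_mul hx0, ← Real.rpow_mul_natCast hκ0,
          ← Real.rpow_mul hx0, show j / β * (α * β) = α * j by field_simp,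
          show (α - j / β) * (α * β) = α * (α * β - j) by field_simp]
      -- Flatness carries its constant to the power `j`; since `j ≥ 1` and `C ^ (αβ) ≥ 1`, the
      -- constant can be raised to that power.
      _ ≤ (C ^ (α * β)) ^ j * (((κ : ℝ) ^ α) ^ j * (f x ^ α) ^ (α * β - j)) := by
        gcongr
        exact le_self_pow₀ hCp (by omega)
      _ = _ := by rw [mul_pow]; ring
  refine (flatSeminorm_le hflat).trans_eq ?_
  rw [ENNReal.coe_mul, ENNReal.coe_rpow_of_nonneg _ hα.le, hκ, ENNReal.coe_toNNReal hfl.ne]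

theorem continuousOn_rpow_of_mem_holderCone (hα : 0 < α) (hβ : 0 < β) {f : ℝ → ℝ}
    (hf : f ∈ holderCone β) : ContinuousOn (fun x => f x ^ α) (Icc 0 1) :=
  (flatBounds_of_mem_holderCone hβ ENNReal.toReal_nonneg hf
    (ENNReal.ofReal_toReal hf.2.2.ne).ge).contDiffOn.continuousOn.rpow_const
      fun _ _ => .inr hα.le

theorem exists_coneNorm_rpow_le (hα : 0 < α) (hα1 : α ≤ 1) (hβ : 0 < β) :
    ∃ C : ℝ≥0, ∀ f ∈ holderCone β,
      coneNorm (α * β) (fun x => f x ^ α) ≤ C * coneNorm β f ^ α := by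
  obtain ⟨C₁, hC₁0, hC₁⟩ := exists_supNorm_der_rpow_le hα hα1 hβ
  obtain ⟨C₂, hC₂0, hC₂⟩ := FlatBounds.exists_abs_der_rpow_sub_le hα hα1 hβ
  obtain ⟨C₃, hC₃⟩ := exists_flatSeminorm_rpow_le hα hα1 hβ
  refine ⟨(1 + C₁ + C₂).toNNReal + C₃, fun f hf => ?_⟩
  rw [ENNReal.coe_add, add_mul]
  refine add_le_add (le_mul_rpow_of_forall_pos hα (by positivity) hf.2.2 fun M hM h => ?_)
    ((hC₃ f hf).trans ?_)
  · have hMα : 0 ≤ M ^ α := by positivity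
    rw [add_mul, add_mul, one_mul, ENNReal.ofReal_add (by positivity) (by positivity),
      ENNReal.ofReal_add hMα (by positivity)]
    exact add_le_add (add_le_add (supNorm_rpow_le hα hf hM h) (hC₁ f hf M hM h))
      (holderSeminorm_le (by positivity)
        (hC₂ _ M f (flatBounds_of_mem_holderCone hβ hM.le hf h) hM))
  · gcongr
    exact le_add_self

theorem exists_besovNorm_rpow_le (hα : 0 < α) (hα1 : α ≤ 1) (hβ : 0 < β) {r : ℕ}
    (hr : α * β < r) : ∃ C : ℝ≥0, ∀ f ∈ holderCone β,
      besovNorm r (α * β) (fun x => f x ^ α) ≤ C * coneNorm β f ^ α := by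
  obtain ⟨C, hC0, hC⟩ := FlatBounds.exists_abs_der_rpow_sub_le hα hα1 hβ
  have hl := (strictFloor_spec (mul_pos hα hβ)).1
  set l := strictFloor (α * β) with hldef
  have hlr : l < r := by exact_mod_cast hl.trans hr
  -- Order `l + 1` already gives the rate `d ^ (αβ)`; each further difference costs a factor `2`.
  obtain ⟨m, rfl⟩ : ∃ m, r = (l + 1) + m := ⟨r - (l + 1), by omega⟩
  refine ⟨(1 + 2 ^ m * C).toNNReal, fun f hf => ?_⟩
  refine le_mul_rpow_of_forall_pos hα (by positivity) hf.2.2 fun M hM h => ?_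
  have hfb := flatBounds_of_mem_holderCone hβ hM.le hf h
  rw [add_mul, one_mul, ENNReal.ofReal_add (by positivity) (by positivity)]
  refine add_le_add (supNorm_rpow_le hα hf hM h) (iSup₂_le fun t ht => ?_)
  have ht0 : 0 < t := ht
  refine ENNReal.div_le_of_le_mul ?_
  rw [← ENNReal.ofReal_mul (by positivity)]
  refine iSup₂_le fun d hd => iSup₂_le fun x hx => iSup_le fun hx' => ?_
  have hd0 : 0 < d := hd.1
  rw [Real.enorm_eq_ofReal_abs]
  refine ENNReal.ofReal_le_ofReal ?_
  have h1 := abs_fwdDiff_iterate_add_le (n := l + 1) hd0.le ordConnected_Icc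
    (fun z hz hz' => abs_fwdDiff_iterate_succ_le hd0 ordConnected_Icc l (fun z => f z ^ α)
      (hfb.derExists_rpow hα hα1) (hC _ M f hfb hM) z hz (by simpa using hz')) m x hx hx'
  refine h1.trans ?_
  have h2 : d ^ (α * β - l) * d ^ l = d ^ (α * β) := by
    rw [← Real.rpow_add_natCast hd0.ne', sub_add_cancel]
  calc 2 ^ m * (C * M ^ α * d ^ (α * β - l) * d ^ l)
      = 2 ^ m * C * M ^ α * (d ^ (α * β - l) * d ^ l) := by ring
    _ ≤ 2 ^ m * C * M ^ α * t ^ (α * β) := by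
      rw [h2]
      have hαβ := mul_pos hα hβ
      gcongr
      exact hd.2

end Estimates

theorem mainTheorem2 (α β : ℝ) (hα : 0 < α) (hα1 : α ≤ 1) (hβ : 0 < β) :
    (∀ r : ℕ, α * β < r → ∃ C : ℝ≥0, ∀ f ∈ holderCone β,
      (fun x => f x ^ α) ∈ besovSpace r (α * β) ∧
      besovNorm r (α * β) (fun x => f x ^ α) ≤ C * coneNorm β f ^ α) ∧
    (∃ C : ℝ≥0, ∀ f ∈ holderCone β,
      DerExists (strictFloor (α * β)) (fun x => f x ^ α) ∧
      flatSeminorm (α * β) (fun x => f x ^ α) ≤ C * flatSeminorm β f ^ α) ∧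
    ((∀ n : ℕ, α * β ≠ n) → ∃ C : ℝ≥0, ∀ f ∈ holderCone β,
      (fun x => f x ^ α) ∈ holderCone (α * β) ∧
      coneNorm (α * β) (fun x => f x ^ α) ≤ C * coneNorm β f ^ α) := by
  have hfin : ∀ f ∈ holderCone β, ∀ C : ℝ≥0, C * coneNorm β f ^ α < ∞ := fun f hf C =>
    ENNReal.mul_lt_top ENNReal.coe_lt_top (ENNReal.rpow_lt_top_of_nonneg hα.le hf.2.2.ne)
  have hder : ∀ f ∈ holderCone β, DerExists (strictFloor (α * β)) (fun x => f x ^ α) :=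
    fun f hf => (flatBounds_of_mem_holderCone hβ ENNReal.toReal_nonneg hf
      (ENNReal.ofReal_toReal hf.2.2.ne).ge).derExists_rpow hα hα1
  refine ⟨fun r hr => ?_, ?_, fun _ => ?_⟩
  · obtain ⟨C, hC⟩ := exists_besovNorm_rpow_le hα hα1 hβ hr
    exact ⟨C, fun f hf => ⟨⟨continuousOn_rpow_of_mem_holderCone hα hβ hf,
      (hC f hf).trans_lt (hfin f hf C)⟩, hC f hf⟩⟩
  · obtain ⟨C, hC⟩ := exists_flatSeminorm_rpow_le hα hα1 hβ
    exact ⟨C, fun f hf => ⟨hder f hf, hC f hf⟩⟩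
  · obtain ⟨C, hC⟩ := exists_coneNorm_rpow_le hα hα1 hβ
    refine ⟨C, fun f hf => ⟨⟨⟨hder f hf, ?_⟩, fun x hx => ?_, ?_⟩, hC f hf⟩⟩
    · exact (le_self_add.trans (hC f hf)).trans_lt (hfin f hf C)
    · exact Real.rpow_nonneg (hf.2.1 x hx) _
    · exact (hC f hf).trans_lt (hfin f hf C)
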